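/- Let $m,n\ge 1$ be integers, let $\eta\in\mathbb C$ be a primitive $m$-th root of unity, and let $W=G(m,1,n)=S_n\ltimes (C_m)^n$. Let $g_i\in W$ be the fixed generator of the $i$-th factor $C_m$ and $s_{ij}\in S_n$ the transposition of $i$ and $j$. Let $V$ be the reflection representation of $W$, with basis $y_1,\dots,y_n$ such that $g_i(y_i)=\eta y_i$, $g_i(y_j)=y_j$ for $j\ne i$, and $\sigma(y_j)=y_{\sigma(j)}$ for $\sigma\in S_n$; let $x_1,\dots,x_n$ be the dual basis of $V^*$. Let $R=\mathbb C[t,\kappa,c_1,\dots,c_{m-1}]$ be the polynomial ring in formal parameters. The generic rational Cherednik algebra $H_R$ of $W$ is the quotient of the smash product $T_R(V\oplus V^*)\rtimes W$ by the relations $$[x_i,x_j]=0,\qquad [y_i,y_j]=0,$$ $$[y_i,x_i]=t-\kappa\sum_{l=0}^{m-1}\sum_{j\neq i}s_{ij}g_i^{-l}g_j^{l}-\sum_{l=1}^{m-1}c_l(1-\eta^{-l})g_i^l,$$ $$[y_i,x_j]=\kappa\sum_{l=0}^{m-1}\eta^{-l}s_{ij}g_i^{-l}g_j^{l}\quad(i\ne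 j).$$ For $1\le i\le n$ put $$z_i=y_ix_i-\tfrac12 t+\kappa\sum_{l=0}^{m-1}\sum_{1\le j<i}s_{ij}g_i^lg_j^{-l}-\sum_{l=1}^{m-1}c_l\eta^{-l}g_i^l\in H_R,$$ and for $r\ge 0$ let $S_r=\sum_{1\le j_1<\dots<j_r\le n}z_{j_1}\cdots z_{j_r}$ be the $r$-th elementary symmetric polynomial in the $z_i$. For $(t_0,\kappa_0,c_0)\in\mathbb C\times\mathbb C\times\mathbb C^{m-1}$ let $\mathfrak m\subset R$ be the corresponding maximal ideal and $H_{t_0,\kappa_0,c_0}=R/\mathfrak m\otimes_R H_R$. Theorem. The elements $z_1,\dots,z_n$ commute pairwise, and for every $r$ $$[x_1,S_r]\in t\,H_R.$$ Consequently, for all $\kappa_0\in\mathbb C$ and $c_0\in\mathbb C^{m-1}$, the image of every $S_r$ in $H_{0,\kappa_0,c_0}$ is central, and more generally every symmetric polynomial with complex coefficients in the images of $z_1,\dots,z_n$ is central in $H_{0,\kappa_0,c_0}$. -/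

import Mathlib

open scoped TensorProduct

noncomputable section

namespace Cherednik

/-- The wreath product `G(m,1,n) = S_n ⋉ (C_m)^n`, where `C_m` is the cyclic group of order `m`
(written multiplicatively) and `S_n` permutes the coordinates, `(σ • f) i = f (σ⁻¹ i)`. -/
abbrev G (m n : ℕ) : Type :=
  (Fin n → Multiplicative (ZMod m)) ⋊[mulAutArrow] Equiv.Perm (Fin n)

/-- The element `g_i`: the fixed generator of `C_m` in the `i`-th place. -/
def g (m n : ℕ) (i : Fin n) : G m n :=
  SemidirectProduct.inl (Pi.mulSingle i (Multiplicative.ofAdd (1 : ZMod m)))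

/-- The inclusion of the symmetric group `S_n` in `G(m,1,n)`. -/
def perm (m n : ℕ) (σ : Equiv.Perm (Fin n)) : G m n :=
  SemidirectProduct.inr σ

/-- The transposition `s_{ij}` as an element of `G(m,1,n)`. -/
def s (m n : ℕ) (i j : Fin n) : G m n :=
  perm m n (Equiv.swap i j)

/-- Labels of the formal parameters `t, κ, c_1, …, c_{m-1}`; the label `c l` with
`l = 0, …, m - 2` stands for `c_{l+1}`. -/
inductive Param (m : ℕ) : Type
  | t : Param m
  | kappa : Param m
  | c (l : Fin (m - 1)) : Param m

/-- The polynomial ring `R = ℂ[t, κ, c_1, …, c_{m-1}]`. -/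
abbrev R (m : ℕ) : Type := MvPolynomial (Param m) ℂ

/-- The formal parameter `t`. -/
def tR (m : ℕ) : R m := MvPolynomial.X Param.t

/-- The formal parameter `κ`. -/
def kappaR (m : ℕ) : R m := MvPolynomial.X Param.kappa

/-- The formal parameter `c_{l+1}`. -/
def cR (m : ℕ) (l : Fin (m - 1)) : R m := MvPolynomial.X (Param.c l)

/-- Generators of the rational Cherednik algebra: the dual basis `x_1, …, x_n` of `V^*`, the basis
`y_1, …, y_n` of `V`, and the group elements. -/
inductive Gen (m n : ℕ) : Type
  | x (i : Fin n) : Gen m n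
  | y (i : Fin n) : Gen m n
  | w (w : G m n) : Gen m n

/-- The free `R`-algebra on the generators. -/
abbrev F (m n : ℕ) : Type := FreeAlgebra (R m) (Gen m n)

/-- `x_i` in the free algebra. -/
def fx (m n : ℕ) (i : Fin n) : F m n := FreeAlgebra.ι (R m) (Gen.x i)

/-- `y_i` in the free algebra. -/
def fy (m n : ℕ) (i : Fin n) : F m n := FreeAlgebra.ι (R m) (Gen.y i)

/-- The group element `w` in the free algebra. -/
def fw (m n : ℕ) (w : G m n) : F m n := FreeAlgebra.ι (R m) (Gen.w w)

/-- The defining relations of the rational Cherednik algebra of `G(m,1,n)`.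

The first six families present the smash product `T_R(V ⊕ V^*) ⋊ W`, where the reflection
representation `V` is given by `g_i y_i = η y_i`, `g_i y_j = y_j` for `j ≠ i`, `σ y_j = y_{σ j}`, and
`V^*` is its dual: `w v = w(v) w` for the generators `w = g_i`, `w = σ` of `W`.
The last four are the commutation relations. -/
inductive Rel (m n : ℕ) (η : ℂ) : F m n → F m n → Prop
  | one : Rel m n η (fw m n 1) 1
  | mul (w w' : G m n) : Rel m n η (fw m n (w * w')) (fw m n w * fw m n w')
  | g_y (i j : Fin n) :
      Rel m n η (fw m n (g m n i) * fy m n j)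
        ((MvPolynomial.C (if i = j then η else 1) : R m) • (fy m n j * fw m n (g m n i)))
  | g_x (i j : Fin n) :
      Rel m n η (fw m n (g m n i) * fx m n j)
        ((MvPolynomial.C (if i = j then η⁻¹ else 1) : R m) • (fx m n j * fw m n (g m n i)))
  | perm_y (σ : Equiv.Perm (Fin n)) (j : Fin n) :
      Rel m n η (fw m n (perm m n σ) * fy m n j) (fy m n (σ j) * fw m n (perm m n σ))
  | perm_x (σ : Equiv.Perm (Fin n)) (j : Fin n) :
      Rel m n η (fw m n (perm m n σ) * fx m n j) (fx m n (σ j) * fw m n (perm m n σ))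
  | x_x (i j : Fin n) : Rel m n η (fx m n i * fx m n j) (fx m n j * fx m n i)
  | y_y (i j : Fin n) : Rel m n η (fy m n i * fy m n j) (fy m n j * fy m n i)
  | y_x_same (i : Fin n) :
      Rel m n η (fy m n i * fx m n i - fx m n i * fy m n i)
        (tR m • (1 : F m n)
          - kappaR m • ∑ l ∈ Finset.range m, ∑ j ∈ Finset.univ.filter (fun j => j ≠ i),
              fw m n (s m n i j * (g m n i)⁻¹ ^ l * g m n j ^ l)
          - ∑ l : Fin (m - 1),
              (cR m l * MvPolynomial.C (1 - η⁻¹ ^ ((l : ℕ) + 1))) •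
                fw m n (g m n i ^ ((l : ℕ) + 1)))
  | y_x_diff (i j : Fin n) (hij : i ≠ j) :
      Rel m n η (fy m n i * fx m n j - fx m n j * fy m n i)
        (kappaR m • ∑ l ∈ Finset.range m,
            (MvPolynomial.C (η⁻¹ ^ l) : R m) •
              fw m n (s m n i j * (g m n i)⁻¹ ^ l * g m n j ^ l))

/-- The generic rational Cherednik algebra `H_R` of `G(m,1,n)`. -/
abbrev H (m n : ℕ) (η : ℂ) : Type := RingQuot (Rel m n η)

/-- The quotient map onto `H_R`. -/
abbrev mk (m n : ℕ) (η : ℂ) : F m n →ₐ[R m] H m n η := RingQuot.mkAlgHom (R m) (Rel m n η)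

/-- The element `x_i` of `H_R`. -/
def x (m n : ℕ) (η : ℂ) (i : Fin n) : H m n η := mk m n η (fx m n i)

/-- The element `y_i` of `H_R`. -/
def y (m n : ℕ) (η : ℂ) (i : Fin n) : H m n η := mk m n η (fy m n i)

/-- The image in `H_R` of the group element `w`. -/
def grp (m n : ℕ) (η : ℂ) (w : G m n) : H m n η := mk m n η (fw m n w)

/-- The modified Dunkl–Opdam elements
`z_i = y_i x_i - t/2 + κ ∑_{l=0}^{m-1} ∑_{j<i} s_{ij} g_i^l g_j^{-l} - ∑_{l=1}^{m-1} c_l η^{-l} g_i^l`. -/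
def z (m n : ℕ) (η : ℂ) (i : Fin n) : H m n η :=
  y m n η i * x m n η i
    - (MvPolynomial.C (1 / 2) * tR m) • (1 : H m n η)
    + kappaR m • ∑ l ∈ Finset.range m, ∑ j ∈ Finset.univ.filter (fun j => j < i),
        grp m n η (s m n i j * g m n i ^ l * (g m n j)⁻¹ ^ l)
    - ∑ l : Fin (m - 1),
        (cR m l * MvPolynomial.C (η⁻¹ ^ ((l : ℕ) + 1))) • grp m n η (g m n i ^ ((l : ℕ) + 1))

/-- `S_r = ∑_{j_1 < ⋯ < j_r} z_{j_1} ⋯ z_{j_r}`; the factors of each product are taken in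
increasing order of the index. -/
def S (m n : ℕ) (η : ℂ) (r : ℕ) : H m n η :=
  ∑ J ∈ Finset.powersetCard r (Finset.univ : Finset (Fin n)),
    ((Finset.sort J (· ≤ ·)).map (z m n η)).prod

/-- The point `(t, κ, c_1, …, c_{m-1})` of `ℂ^{m+1}`. -/
def point (m : ℕ) (t κ : ℂ) (c : Fin (m - 1) → ℂ) : Param m → ℂ
  | Param.t => t
  | Param.kappa => κ
  | Param.c l => c l

/-- The maximal ideal of `R` of polynomials vanishing at the point `(t, κ, c_1, …, c_{m-1})`. -/
def maxIdeal (m : ℕ) (t κ : ℂ) (c : Fin (m - 1) → ℂ) : Ideal (R m) :=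
  RingHom.ker (MvPolynomial.eval (point m t κ c))

/-- The specialised algebra `H_{t,c} = R/m_{t,c} ⊗_R H_R`. -/
abbrev Hspec (m n : ℕ) (η : ℂ) (t κ : ℂ) (c : Fin (m - 1) → ℂ) : Type :=
  (R m ⧸ maxIdeal m t κ c) ⊗[R m] H m n η

/-- The specialisation `1 ⊗ h` in `H_{t,c}` of an element `h` of `H_R`. -/
def spec (m n : ℕ) (η : ℂ) (t κ : ℂ) (c : Fin (m - 1) → ℂ) (h : H m n η) :
    Hspec m n η t κ c :=
  (1 : R m ⧸ maxIdeal m t κ c) ⊗ₜ[R m] h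

/-- The value `f(a_1, …, a_n)` of a complex polynomial at elements of a (possibly noncommutative)
`ℂ`-algebra, with every monomial written as `a_1^{e_1} ⋯ a_n^{e_n}`. For pairwise commuting `a_i`
this is the usual evaluation. -/
def evalOrdered {n : ℕ} {A : Type} [Ring A] [Algebra ℂ A] (a : Fin n → A)
    (f : MvPolynomial (Fin n) ℂ) : A :=
  ∑ e ∈ f.support, f.coeff e • (List.ofFn (fun i => a i ^ e i)).prod

end Cherednik

end

namespace Cherednik

/-! ### Symmetric polynomials in commuting elements of a noncommutative ring -/

section Symmetric

variable {n : ℕ} {K A B : Type*} [CommRing K] [Ring A] [Algebra K A] [CommRing B] [Algebra K B]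

/-! Write `z i = (p i + J i) - (half + γ i)` with p_i = y_i x_i and J_i = ∑_{j<i} P_{ij}, an
analogue of a Jucys–Murphy element. Moving x_i past y_j gives [p_i, p_j] = (p_j − p_i) P_{ij}, and J
repairs exactly this defect, so the z_i commute (`DunklOpdamData.commute_z`).

Centrality at t = 0 is checked on generators. Each g_i commutes with every z_j. An adjacent
transposition s satisfies degenerate affine Hecke relations, s z_a = z_b s − E_{ab} with E_{ab}
commuting with all z's; hence it commutes with z_a + z_b, with z_a z_b and with the other z's, and
so with every symmetric polynomial. For the long cycle τ, i ↦ i + 1, the intertwiners x_n τ⁻¹ and τ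
y_n shift the z_i cyclically, the only defect being a t when the index wraps around
(`z_mul_intertwiner_X`, `z_mul_intertwiner_Y`). At t = 0 they permute the z_i, so they too commute
with symmetric polynomials; multiplying by permutations recovers all x_i and y_i.

This works in any quotient of H_R killing t. Taking H_R / t H_R gives [x_1, S_r] ∈ t H_R, and taking
R/𝔪 ⊗ H_R gives the specialised statements; no basis theorem is needed. Polynomials are evaluated in
a commutative ring B and carried over by a map ι. -/

/-- A subring containing all `b l` with `l ≠ i, j`, as well as `b i + b j` and `b i * b j`,
contains the elementary symmetric polynomials in the `b l`. -/
theorem esymm_mem_of_pair (b : Fin n → B) (D : Subring B) {i j : Fin n} (hij : i ≠ j)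
    (hl : ∀ l, l ≠ i → l ≠ j → b l ∈ D) (hadd : b i + b j ∈ D) (hmul : b i * b j ∈ D) (r : ℕ) :
    MvPolynomial.aeval b (MvPolynomial.esymm (Fin n) K r) ∈ D := by
  -- For r > n the polynomial is 0; otherwise it is the coefficient of X^(n-r) below, where the
  -- natural subtraction is honest.
  rcases lt_or_ge n r with hr | hr
  · rw [MvPolynomial.esymm, Finset.powersetCard_eq_empty.2 (by simpa using hr)]
    simp
  have hC : ∀ a ∈ D, (Polynomial.C a : Polynomial B) ∈ Polynomial.lifts D.subtype :=
    fun a ha => Polynomial.C_mem_lifts D.subtype ⟨a, ha⟩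
  have hX := Polynomial.X_mem_lifts D.subtype
  -- The generating polynomial has coefficients in `D`: its i-th and j-th factors enter only through
  -- their product, a quadratic in b_i + b_j and b_i b_j.
  have hprod : ∏ l, (Polynomial.X + Polynomial.C (b l)) ∈ Polynomial.lifts D.subtype := by
    rw [← Finset.mul_prod_erase _ _ (Finset.mem_univ i),
      ← Finset.mul_prod_erase _ _ (Finset.mem_erase.2 ⟨hij.symm, Finset.mem_univ j⟩), ← mul_assoc]
    refine mul_mem ?_ (prod_mem fun l hmem => ?_)
    · have : (Polynomial.X + Polynomial.C (b i)) * (Polynomial.X + Polynomial.C (b j))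
          = Polynomial.X * Polynomial.X + Polynomial.C (b i + b j) * Polynomial.X
            + Polynomial.C (b i * b j) := by
        simp only [Polynomial.C_add, Polynomial.C_mul]; ring
      rw [this]
      exact add_mem (add_mem (mul_mem hX hX) (mul_mem (hC _ hadd) hX)) (hC _ hmul)
    · simp only [Finset.mem_erase, Finset.mem_univ, and_true] at hmem
      exact add_mem hX (hC _ (hl l hmem.2 hmem.1))
  have hcoeff := (Polynomial.lifts_iff_coeff_lifts _).1 hprod (n - r)
  rw [Finset.prod_X_add_C_coeff _ _ (by simp), Finset.card_univ, Fintype.card_fin,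
    Nat.sub_sub_self hr] at hcoeff
  obtain ⟨d, hd⟩ := hcoeff
  have : MvPolynomial.aeval b (MvPolynomial.esymm (Fin n) K r) = D.subtype d := by
    rw [hd, MvPolynomial.esymm]; simp
  rw [this]
  exact d.2

/-- A symmetric polynomial evaluates into every subalgebra that contains the values of the
elementary symmetric polynomials. -/
theorem aeval_mem_of_isSymmetric (b : Fin n → B) (D : Subalgebra K B)
    (hD : ∀ r, MvPolynomial.aeval b (MvPolynomial.esymm (Fin n) K r) ∈ D)
    {f : MvPolynomial (Fin n) K} (hf : f.IsSymmetric) : MvPolynomial.aeval b f ∈ D := by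
  -- Fundamental theorem of symmetric polynomials; the variable i of `q` stands for e_{i+1}.
  obtain ⟨q, hq⟩ := MvPolynomial.esymmAlgHom_surjective K (σ := Fin n) (n := n) (by simp) ⟨f, hf⟩
  have hq' : MvPolynomial.aeval (fun i : Fin n => MvPolynomial.esymm (Fin n) K (i + 1)) q = f := by
    rw [← MvPolynomial.esymmAlgHom_apply, hq]
  rw [← hq']
  clear hq hq' hf
  induction q using MvPolynomial.induction_on with
  | C a => simp
  | add p q hp hq =>
    rw [map_add, map_add]
    exact add_mem hp hq
  | mul_X p i hp =>
    rw [map_mul, map_mul, MvPolynomial.aeval_X]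
    exact mul_mem hp (hD _)

/-- If `u` commutes with all `a l`, `l ≠ i, j`, with `a i + a j` and with `a i * a j`, then it
commutes with every symmetric polynomial in the `a l`. -/
theorem commute_aeval_of_pair (ι : B →ₐ[K] A) (b : Fin n → B) {i j : Fin n} (hij : i ≠ j) {u : A}
    (hl : ∀ l, l ≠ i → l ≠ j → Commute u (ι (b l))) (hadd : Commute u (ι (b i) + ι (b j)))
    (hmul : Commute u (ι (b i) * ι (b j))) {f : MvPolynomial (Fin n) K} (hf : f.IsSymmetric) :
    Commute u (ι (MvPolynomial.aeval b f)) := by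
  let D : Subalgebra K B := (Subalgebra.centralizer K {u}).comap ι
  have hmem : ∀ a : B, a ∈ D ↔ Commute u (ι a) := fun a => by
    simp [D, Subalgebra.mem_centralizer_iff, commute_iff_eq]
  rw [← hmem]
  refine aeval_mem_of_isSymmetric b D (fun r => ?_) hf
  refine esymm_mem_of_pair b D.toSubring hij (fun l h₁ h₂ => (hmem _).2 (hl l h₁ h₂))
    ((hmem _).2 ?_) ((hmem _).2 ?_) r
  · rwa [map_add]
  · rwa [map_mul]

/-- If `u` permutes the elements `a l`, then it commutes with every symmetric polynomial in the
`a l`. -/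
theorem commute_aeval_of_perm (ι : B →ₐ[K] A) (b : Fin n → B) (ρ : Equiv.Perm (Fin n)) {u : A}
    (h : ∀ l, ι (b l) * u = u * ι (b (ρ l))) {f : MvPolynomial (Fin n) K} (hf : f.IsSymmetric) :
    Commute u (ι (MvPolynomial.aeval b f)) := by
  -- Moving u across the value of any polynomial renames its variables by ρ; symmetry enters only at
  -- the end.
  have key : ∀ p : MvPolynomial (Fin n) K, ι (MvPolynomial.aeval b p) * u
      = u * ι (MvPolynomial.aeval b (MvPolynomial.rename ρ p)) := by
    intro p
    induction p using MvPolynomial.induction_on with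
    | C a => simp [Algebra.commutes]
    | add p q hp hq => simp only [map_add, add_mul, mul_add, hp, hq]
    | mul_X p i hp =>
      simp only [map_mul, MvPolynomial.aeval_X, MvPolynomial.rename_X]
      rw [mul_assoc, h, ← mul_assoc, hp, mul_assoc]
  have := key f
  rw [hf ρ] at this
  exact this.symm

/-- `∑_{j_1 < ⋯ < j_r} a_{j_1} ⋯ a_{j_r}` is the value of the elementary symmetric polynomial. -/
theorem orderedEsymm_eq (ι : B →ₐ[K] A) (b : Fin n → B) (r : ℕ) :
    ∑ J ∈ Finset.powersetCard r (Finset.univ : Finset (Fin n)),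
        ((Finset.sort J (· ≤ ·)).map fun i => ι (b i)).prod
      = ι (MvPolynomial.aeval b (MvPolynomial.esymm (Fin n) K r)) := by
  rw [MvPolynomial.esymm, map_sum, map_sum]
  refine Finset.sum_congr rfl fun J _ => ?_
  have : ((Finset.sort J (· ≤ ·)).map fun i => ι (b i)).prod
      = ι ((Finset.sort J (· ≤ ·)).map b).prod := by
    rw [map_list_prod, List.map_map]; rfl
  rw [this, map_prod]
  congr 1
  simp only [MvPolynomial.aeval_X]
  rw [← List.prod_toFinset _ (Finset.sort_nodup J _), Finset.sort_toFinset]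

theorem evalOrdered_eq {A B : Type} [Ring A] [Algebra ℂ A] [CommRing B] [Algebra ℂ B]
    (ι : B →ₐ[ℂ] A) (b : Fin n → B) (f : MvPolynomial (Fin n) ℂ) :
    evalOrdered (fun i => ι (b i)) f = ι (MvPolynomial.aeval b f) := by
  rw [MvPolynomial.aeval_def, MvPolynomial.eval₂_eq', map_sum, evalOrdered]
  refine Finset.sum_congr rfl fun e _ => ?_
  rw [map_mul, AlgHom.commutes, Algebra.smul_def, ← List.prod_ofFn, map_list_prod, List.map_ofFn]
  congr 3
  funext i
  simp

end Symmetric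
end Cherednik

namespace Cherednik

/-! ### Dunkl–Opdam elements from their commutation relations -/

/-- The commutation relations of the rational Cherednik algebra of `G(m,1,n)` in terms of the
generators `x_i`, `y_i`, `σ ∈ S_n` and of the elements
* `half = t / 2`,
* `γ_i = ∑ c_l η^{-l} g_i^l` and `ψ_i = ∑ c_l g_i^l`,
* `E_{ij} = κ ∑ g_i^l g_j^{-l}`,
* `Q_{ij} = κ ∑ η^{-l} s_{ij} g_i^{-l} g_j^l`. -/
structure DunklOpdamData (n : ℕ) (A : Type*) [Ring A] where
  X : Fin n → A
  Y : Fin n → A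
  γ : Fin n → A
  ψ : Fin n → A
  E : Fin n → Fin n → A
  Q : Fin n → Fin n → A
  half : A
  sg : Equiv.Perm (Fin n) →* A
  half_comm : ∀ a, Commute half a
  sg_X : ∀ σ i, sg σ * X i = X (σ i) * sg σ
  sg_Y : ∀ σ i, sg σ * Y i = Y (σ i) * sg σ
  sg_γ : ∀ σ i, sg σ * γ i = γ (σ i) * sg σ
  sg_E : ∀ σ i j, sg σ * E i j = E (σ i) (σ j) * sg σ
  X_comm : ∀ i j, Commute (X i) (X j)
  Y_comm : ∀ i j, Commute (Y i) (Y j)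
  E_symm : ∀ i j, E i j = E j i
  E_X : ∀ i j k, k ≠ i → k ≠ j → Commute (E i j) (X k)
  E_Y : ∀ i j k, k ≠ i → k ≠ j → Commute (E i j) (Y k)
  E_YX : ∀ i j k, Commute (E i j) (Y k * X k)
  E_sg_E : ∀ i j k l, Commute (E i j) (sg (Equiv.swap k l) * E k l)
  E_γ : ∀ i j k, Commute (E i j) (γ k)
  γ_X : ∀ i k, k ≠ i → Commute (γ i) (X k)
  γ_Y : ∀ i k, k ≠ i → Commute (γ i) (Y k)
  γ_YX : ∀ i k, Commute (γ i) (Y k * X k)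
  γ_sg_E : ∀ i k l, Commute (γ i) (sg (Equiv.swap k l) * E k l)
  γ_γ : ∀ i j, Commute (γ i) (γ j)
  ψ_X : ∀ i, ψ i * X i = X i * γ i
  γ_Y_same : ∀ i, γ i * Y i = Y i * ψ i
  Q_X : ∀ i j, i ≠ j → Q i j * X i = X j * (sg (Equiv.swap i j) * E i j)
  Y_Q : ∀ i j, i ≠ j → Y j * Q i j = sg (Equiv.swap i j) * E i j * Y i
  yx_same : ∀ i, Y i * X i = X i * Y i + (half + half)
    - ∑ j ∈ Finset.univ.filter (fun j => j ≠ i), sg (Equiv.swap i j) * E i j + γ i - ψ i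
  yx_diff : ∀ i j, i ≠ j → Y i * X j = X j * Y i + Q i j

namespace DunklOpdamData

variable {n : ℕ} {A : Type*} [Ring A]

/-! ### Commutativity and degenerate affine Hecke relations. -/

section

variable (D : DunklOpdamData n A)

/-- The element `κ ∑ s_{ij} g_i^l g_j^{-l}`. -/
def P (i j : Fin n) : A := D.sg (Equiv.swap i j) * D.E i j

/-- The product `y_i x_i`. -/
def p (i : Fin n) : A := D.Y i * D.X i

/-- The analogue `∑_{j < i} P_{ij}` of a Jucys–Murphy element. -/
def J (i : Fin n) : A := ∑ j ∈ Finset.univ.filter (fun j => j < i), D.P i j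

/-- The Dunkl–Opdam element. -/
def z (i : Fin n) : A := D.p i - D.half + D.J i - D.γ i

theorem P_symm (i j : Fin n) : D.P i j = D.P j i := by
  rw [P, P, Equiv.swap_comm, D.E_symm]

theorem sg_p (σ : Equiv.Perm (Fin n)) (i : Fin n) : D.sg σ * D.p i = D.p (σ i) * D.sg σ := by
  rw [p, p, ← mul_assoc, D.sg_Y, mul_assoc, D.sg_X, mul_assoc]

theorem sg_P (σ : Equiv.Perm (Fin n)) (i j : Fin n) :
    D.sg σ * D.P i j = D.P (σ i) (σ j) * D.sg σ := by
  have h : σ * Equiv.swap i j = Equiv.swap (σ i) (σ j) * σ := by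
    rw [Equiv.swap_apply_apply]; group
  rw [P, P, ← mul_assoc, ← map_mul, h, map_mul, mul_assoc, D.sg_E, mul_assoc]

/-- Since `E i j` commutes with every y_k x_k, only the transposition in `P i j` acts. The same
mechanism gives `P_mul_P`. -/
theorem P_mul_p (i j k : Fin n) :
    D.P i j * D.p k = D.p (Equiv.swap i j k) * D.P i j := by
  have h : Commute (D.E i j) (D.p k) := D.E_YX i j k
  rw [P, mul_assoc, h.eq, ← mul_assoc, sg_p, mul_assoc]

theorem P_mul_P (i j k l : Fin n) :
    D.P i j * D.P k l = D.P (Equiv.swap i j k) (Equiv.swap i j l) * D.P i j := by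
  have h : Commute (D.E i j) (D.P k l) := D.E_sg_E i j k l
  rw [P, mul_assoc, h.eq, ← mul_assoc, sg_P, mul_assoc]

theorem commute_P_X {i j k : Fin n} (hi : k ≠ i) (hj : k ≠ j) : Commute (D.P i j) (D.X k) := by
  refine Commute.mul_left ?_ (D.E_X i j k hi hj)
  rw [commute_iff_eq, D.sg_X, Equiv.swap_apply_of_ne_of_ne hi hj]

theorem commute_P_Y {i j k : Fin n} (hi : k ≠ i) (hj : k ≠ j) : Commute (D.P i j) (D.Y k) := by
  refine Commute.mul_left ?_ (D.E_Y i j k hi hj)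
  rw [commute_iff_eq, D.sg_Y, Equiv.swap_apply_of_ne_of_ne hi hj]

/-- The first term on the right is symmetric in i and j, so the noncommutativity of the p's lies
entirely in the correction, which comes from exchanging x_i and y_j. -/
theorem p_mul_p {i j : Fin n} (hij : i ≠ j) :
    D.p i * D.p j = D.Y i * D.Y j * (D.X i * D.X j) - D.p i * D.P i j := by
  have h : D.X i * D.Y j = D.Y j * D.X i - D.Q j i := by
    rw [D.yx_diff j i hij.symm, add_sub_cancel_right]
  have hQ : D.Q j i * D.X j = D.X i * D.P i j := by
    rw [D.Q_X j i hij.symm, P_symm]; rfl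
  calc D.p i * D.p j = D.Y i * (D.X i * D.Y j) * D.X j := by simp only [p, mul_assoc]
    _ = D.Y i * D.Y j * (D.X i * D.X j) - D.Y i * (D.Q j i * D.X j) := by
      rw [h]; simp only [mul_sub, sub_mul, mul_assoc]
    _ = _ := by rw [hQ, p, mul_assoc (D.Y i) (D.X i)]

/-- [p_i, p_j] = (p_j − p_i) P_{ij} is cancelled by [p_i, P_{ji}] = (p_i − p_j) P_{ij}. -/
theorem commute_p_p_add_P {i j : Fin n} (hij : i ≠ j) : Commute (D.p i) (D.p j + D.P j i) := by
  have h₁ := D.p_mul_p hij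
  have h₂ := D.p_mul_p hij.symm
  rw [(D.Y_comm j i).eq, (D.X_comm j i).eq] at h₂
  have h₃ := D.P_mul_p j i i
  rw [Equiv.swap_apply_right] at h₃
  rw [commute_iff_eq, mul_add, add_mul, h₁, h₂, h₃, D.P_symm i j]
  abel

theorem commute_p_J_sub {i j : Fin n} (hij : i < j) : Commute (D.p i) (D.J j - D.P j i) := by
  have : D.J j - D.P j i
      = ∑ k ∈ (Finset.univ.filter (fun k => k < j)).erase i, D.P j k := by
    rw [J, ← Finset.add_sum_erase _ _ (show i ∈ Finset.univ.filter (fun k => k < j) by simpa),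
      add_sub_cancel_left]
  rw [this]
  refine Commute.sum_right _ _ _ fun k hk => ?_
  simp only [Finset.mem_erase, Finset.mem_filter, Finset.mem_univ, true_and] at hk
  rw [commute_iff_eq, P_mul_p, Equiv.swap_apply_of_ne_of_ne hij.ne hk.1.symm]

/-- As for Jucys–Murphy elements: the transposition of i, k < j fixes j and permutes the summands of
`J j`. -/
theorem commute_P_J {i j k : Fin n} (hi : i < j) (hk : k < j) : Commute (D.P i k) (D.J j) := by
  rw [commute_iff_eq, J, Finset.mul_sum, Finset.sum_mul]
  refine Finset.sum_equiv (Equiv.swap i k) (fun l => ?_) (fun l _ => ?_)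
  · simp only [Finset.mem_filter, Finset.mem_univ, true_and]
    rw [Equiv.swap_apply_def]
    split_ifs <;> simp_all
  · rw [P_mul_P, Equiv.swap_apply_of_ne_of_ne hi.ne' hk.ne']

/-- The summand `P j i` of `J j` is spent on making p_i commute with p_j; everything else commutes
termwise. -/
theorem commute_p_add_J {i j : Fin n} (hij : i < j) :
    Commute (D.p i + D.J i) (D.p j + D.J j) := by
  have h : D.p j + D.J j = (D.p j + D.P j i) + (D.J j - D.P j i) := by abel
  refine Commute.add_left ?_ (Commute.sum_left _ _ _ fun k hk => ?_)
  · rw [h]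
    exact (D.commute_p_p_add_P hij.ne).add_right (D.commute_p_J_sub hij)
  · simp only [Finset.mem_filter, Finset.mem_univ, true_and] at hk
    refine Commute.add_right ?_ (D.commute_P_J hij (hk.trans hij))
    rw [commute_iff_eq, P_mul_p, Equiv.swap_apply_of_ne_of_ne hij.ne' (hk.trans hij).ne']

theorem commute_γ_p_add_J (i j : Fin n) : Commute (D.γ i) (D.p j + D.J j) :=
  Commute.add_right (D.γ_YX i j) (Commute.sum_right _ _ _ fun _ _ => D.γ_sg_E i j _)

theorem z_eq (i : Fin n) : D.z i = (D.p i + D.J i) - (D.half + D.γ i) := by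
  rw [z]; abel

/-- The Dunkl–Opdam elements commute pairwise. -/
theorem commute_z (i j : Fin n) : Commute (D.z i) (D.z j) := by
  have key : ∀ i j, Commute (D.p i + D.J i) (D.p j + D.J j) := fun i j => by
    rcases lt_trichotomy i j with h | rfl | h
    · exact D.commute_p_add_J h
    · exact Commute.refl _
    · exact (D.commute_p_add_J h).symm
  rw [z_eq, z_eq]
  refine Commute.sub_left (Commute.sub_right (key i j) ?_) (Commute.sub_right ?_ ?_)
  · exact ((D.half_comm _).add_left (D.commute_γ_p_add_J j i)).symm
  · exact (D.half_comm _).add_left (D.commute_γ_p_add_J i j)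
  · exact (D.half_comm _).add_left ((D.half_comm _).symm.add_right (D.γ_γ i j))

theorem commute_E_z (i j k : Fin n) : Commute (D.E i j) (D.z k) := by
  rw [z_eq]
  refine Commute.sub_right (Commute.add_right (D.E_YX i j k)
    (Commute.sum_right _ _ _ fun _ _ => D.E_sg_E i j k _)) ?_
  exact (D.half_comm _).symm.add_right (D.E_γ i j k)

theorem sg_J (σ : Equiv.Perm (Fin n)) (i : Fin n) : D.sg σ * D.J i
    = (∑ j ∈ Finset.univ.filter (fun j => j < i), D.P (σ i) (σ j)) * D.sg σ := by
  rw [J, Finset.mul_sum, Finset.sum_mul]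
  exact Finset.sum_congr rfl fun j _ => D.sg_P σ i j

/-- A permutation need not preserve the order, so the sum on the right is not `J (σ i)` in general.
The lemmas for adjacent swaps and for the rotation measure the difference. -/
theorem sg_z (σ : Equiv.Perm (Fin n)) (i : Fin n) : D.sg σ * D.z i
    = (D.p (σ i) - D.half + ∑ j ∈ Finset.univ.filter (fun j => j < i), D.P (σ i) (σ j)
        - D.γ (σ i)) * D.sg σ := by
  rw [z]
  simp only [mul_sub, mul_add, sub_mul, add_mul, D.sg_p, D.sg_J, D.sg_γ, (D.half_comm (D.sg σ)).eq]

/-- Here `hab` says that b is the successor of a. Hence the indices below l include both a and b or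
neither, and the swap preserves them. -/
theorem sg_swap_z_of_ne {a b : Fin n} (hab : ∀ l, l < b ↔ l < a ∨ l = a) {l : Fin n} (hla : l ≠ a)
    (hlb : l ≠ b) : Commute (D.sg (Equiv.swap a b)) (D.z l) := by
  rw [commute_iff_eq, sg_z, z, J, Equiv.swap_apply_of_ne_of_ne hla hlb]
  congr 3
  refine Finset.sum_equiv (Equiv.swap a b) (fun k => ?_) (fun k _ => rfl)
  have h₁ := hab l
  have h₂ := hab a
  have : a < l ↔ b < l := by
    rw [← not_le, ← not_le, le_iff_lt_or_eq, le_iff_lt_or_eq, h₁]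
    tauto
  simp only [Finset.mem_filter, Finset.mem_univ, true_and]
  rw [Equiv.swap_apply_def]
  split_ifs <;> simp_all

/-- `J b` has one summand more than the conjugate of `J a`, namely `P b a`, and multiplying it by
the swap leaves `E a b`. -/
theorem sg_swap_z_left {a b : Fin n} (hab : ∀ l, l < b ↔ l < a ∨ l = a) :
    D.sg (Equiv.swap a b) * D.z a = D.z b * D.sg (Equiv.swap a b) - D.E a b := by
  have hlt : a < b := (hab a).2 (Or.inr rfl)
  have hs : Finset.univ.filter (fun l => l < b)
      = insert a (Finset.univ.filter (fun l => l < a)) := by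
    ext l; simp [hab, or_comm]
  have hJ : ∑ j ∈ Finset.univ.filter (fun j => j < a),
      D.P (Equiv.swap a b a) (Equiv.swap a b j) = D.J b - D.P b a := by
    rw [J, hs, Finset.sum_insert (by simp), add_sub_cancel_left, Equiv.swap_apply_left]
    refine Finset.sum_congr rfl fun j hj => ?_
    simp only [Finset.mem_filter, Finset.mem_univ, true_and] at hj
    rw [Equiv.swap_apply_of_ne_of_ne hj.ne (hj.trans hlt).ne]
  have hE : D.P b a * D.sg (Equiv.swap a b) = D.E a b := by
    rw [P_symm, P, mul_assoc]
    nth_rw 2 [D.E_symm]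
    have := D.sg_E (Equiv.swap a b) a b
    rw [Equiv.swap_apply_left, Equiv.swap_apply_right] at this
    rw [D.E_symm a b] at this ⊢
    rw [← this, ← mul_assoc, ← map_mul, Equiv.swap_mul_self, map_one, one_mul]
  rw [sg_z, hJ, Equiv.swap_apply_left, ← hE, ← sub_mul, z]
  congr 1
  abel

theorem z_sg_swap_left {a b : Fin n} (hab : ∀ l, l < b ↔ l < a ∨ l = a) :
    D.z a * D.sg (Equiv.swap a b) = D.sg (Equiv.swap a b) * D.z b - D.E a b := by
  have hs : D.sg (Equiv.swap a b) * D.sg (Equiv.swap a b) = 1 := by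
    rw [← map_mul, Equiv.swap_mul_self, map_one]
  have hE := D.sg_E (Equiv.swap a b) a b
  rw [Equiv.swap_apply_left, Equiv.swap_apply_right, D.E_symm b a] at hE
  calc D.z a * D.sg (Equiv.swap a b)
      = D.sg (Equiv.swap a b) * (D.sg (Equiv.swap a b) * D.z a) * D.sg (Equiv.swap a b) := by
        rw [← mul_assoc, hs, one_mul]
    _ = D.sg (Equiv.swap a b) * D.z b * (D.sg (Equiv.swap a b) * D.sg (Equiv.swap a b))
          - D.E a b * (D.sg (Equiv.swap a b) * D.sg (Equiv.swap a b)) := by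
        rw [D.sg_swap_z_left hab, mul_sub, hE, sub_mul]
        simp only [mul_assoc]
    _ = _ := by rw [hs, mul_one, mul_one]

theorem commute_sg_swap_add {a b : Fin n} (hab : ∀ l, l < b ↔ l < a ∨ l = a) :
    Commute (D.sg (Equiv.swap a b)) (D.z a + D.z b) := by
  rw [commute_iff_eq, mul_add, add_mul, D.sg_swap_z_left hab, D.z_sg_swap_left hab]
  abel

/-- The two `E a b` terms cancel because `E a b` commutes with z_b. -/
theorem commute_sg_swap_mul {a b : Fin n} (hab : ∀ l, l < b ↔ l < a ∨ l = a) :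
    Commute (D.sg (Equiv.swap a b)) (D.z a * D.z b) := by
  have h : D.sg (Equiv.swap a b) * D.z b = D.z a * D.sg (Equiv.swap a b) + D.E a b := by
    rw [D.z_sg_swap_left hab, sub_add_cancel]
  rw [commute_iff_eq, ← mul_assoc, D.sg_swap_z_left hab, sub_mul, mul_assoc, h, mul_add,
    (D.commute_E_z a b b).eq, add_sub_cancel_right, ← mul_assoc, (D.commute_z b a).eq]

end

/-! ### The long cycle and the intertwiners. -/

section Rotate

variable {k : ℕ} (D : DunklOpdamData (k + 1) A)

theorem finRotate_lt_finRotate_iff {i : Fin (k + 1)} (hi : i ≠ Fin.last k) (j : Fin (k + 1)) :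
    finRotate (k + 1) j < finRotate (k + 1) i ↔ j = Fin.last k ∨ j < i := by
  rw [Fin.lt_def, coe_finRotate, coe_finRotate, if_neg hi]
  split_ifs with h
  · simp [h]
  · simp [h]

/-- The rotation sends the largest index to 0, which lies below i + 1; `P i (Fin.last k)` supplies
the summand of `J (i + 1)` this creates. -/
theorem sg_rotate_z_add {i : Fin (k + 1)} (hi : i ≠ Fin.last k) :
    D.sg (finRotate (k + 1)) * (D.z i + D.P i (Fin.last k))
      = D.z (finRotate (k + 1) i) * D.sg (finRotate (k + 1)) := by
  have hJ : D.J (finRotate (k + 1) i) = ∑ j ∈ Finset.univ.filter (fun j => j < i),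
      D.P (finRotate (k + 1) i) (finRotate (k + 1) j)
        + D.P (finRotate (k + 1) i) (finRotate (k + 1) (Fin.last k)) := by
    have hs : Fin.last k ∉ Finset.univ.filter (fun j => j < i) := by
      simp [Fin.le_last]
    rw [J, add_comm (Finset.sum _ _), ← Finset.sum_insert (f := fun j => D.P (finRotate (k + 1) i)
      (finRotate (k + 1) j)) hs]
    refine (Finset.sum_equiv (finRotate (k + 1)) (fun j => ?_) (fun _ _ => rfl)).symm
    simp only [Finset.mem_filter, Finset.mem_univ, true_and, Finset.mem_insert]
    exact (finRotate_lt_finRotate_iff hi j).symm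
  rw [mul_add, sg_z, sg_P, ← add_mul, z, hJ]
  congr 1
  abel

theorem sg_rotate_last :
    D.sg (finRotate (k + 1)) * (D.p (Fin.last k) - D.half - D.γ (Fin.last k))
      = D.z 0 * D.sg (finRotate (k + 1)) := by
  have hJ : D.J 0 = 0 := by simp [J]
  rw [z, hJ, add_zero]
  simp only [mul_sub, sub_mul, D.sg_p, D.sg_γ, (D.half_comm (D.sg _)).eq, finRotate_last]

theorem J_last : D.J (Fin.last k)
    = ∑ j ∈ Finset.univ.filter (fun j => j ≠ Fin.last k), D.P (Fin.last k) j := by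
  simp only [J, Fin.lt_last_iff_ne_last]

/-- All other indices lie below the last one, so `J` cancels the whole reflection sum in [y_n, x_n].
This is why the intertwiners use x_n and y_n. -/
theorem z_last : D.z (Fin.last k)
    = D.X (Fin.last k) * D.Y (Fin.last k) + D.half - D.ψ (Fin.last k) := by
  have h : D.p (Fin.last k) = D.X (Fin.last k) * D.Y (Fin.last k) + (D.half + D.half)
      - D.J (Fin.last k) + D.γ (Fin.last k) - D.ψ (Fin.last k) := by
    rw [J_last]; exact D.yx_same _
  rw [z, h]
  abel

/-- [y_i, x_n] produces exactly the term `P i (Fin.last k)` that `sg_rotate_z_add` absorbs. -/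
theorem z_mul_X_last {i : Fin (k + 1)} (hi : i ≠ Fin.last k) :
    D.z i * D.X (Fin.last k) = D.X (Fin.last k) * (D.z i + D.P i (Fin.last k)) := by
  have hp : D.p i * D.X (Fin.last k) = D.X (Fin.last k) * (D.p i + D.P i (Fin.last k)) := by
    rw [p, mul_assoc, (D.X_comm i _).eq, ← mul_assoc, D.yx_diff i _ hi, add_mul, D.Q_X i _ hi,
      mul_add, mul_assoc]
    rfl
  have hJ : Commute (D.J i) (D.X (Fin.last k)) := Commute.sum_left _ _ _ fun j hj => by
    simp only [Finset.mem_filter, Finset.mem_univ, true_and] at hj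
    exact D.commute_P_X hi.symm (hj.trans_le (Fin.le_last i)).ne'
  have hγ := D.γ_X i _ hi.symm
  rw [z]
  simp only [sub_mul, add_mul, mul_sub, mul_add, hp, hJ.eq, hγ.eq, (D.half_comm _).eq]
  abel

/-- Compared with `sg_rotate_last`, `half` has the opposite sign: this is the source of the t in the
wrap-around. -/
theorem z_last_mul_X_last : D.z (Fin.last k) * D.X (Fin.last k)
    = D.X (Fin.last k) * (D.p (Fin.last k) + D.half - D.γ (Fin.last k)) := by
  rw [z_last]
  simp only [sub_mul, add_mul, mul_sub, mul_add, D.ψ_X, (D.half_comm _).eq, p, mul_assoc]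

theorem z_add_mul_Y_last {i : Fin (k + 1)} (hi : i ≠ Fin.last k) :
    (D.z i + D.P i (Fin.last k)) * D.Y (Fin.last k) = D.Y (Fin.last k) * D.z i := by
  have hp : D.p i * D.Y (Fin.last k) + D.P i (Fin.last k) * D.Y (Fin.last k)
      = D.Y (Fin.last k) * D.p i := by
    have h : D.X i * D.Y (Fin.last k) = D.Y (Fin.last k) * D.X i - D.Q (Fin.last k) i := by
      rw [D.yx_diff _ i hi.symm, add_sub_cancel_right]
    have hQ : D.Y i * D.Q (Fin.last k) i = D.P i (Fin.last k) * D.Y (Fin.last k) := by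
      rw [D.Y_Q _ _ hi.symm, P_symm]; rfl
    rw [p, mul_assoc, h, mul_sub, hQ, sub_add_cancel, ← mul_assoc, ← mul_assoc, (D.Y_comm i _).eq]
  have hJ : Commute (D.J i) (D.Y (Fin.last k)) := Commute.sum_left _ _ _ fun j hj => by
    simp only [Finset.mem_filter, Finset.mem_univ, true_and] at hj
    exact D.commute_P_Y hi.symm (hj.trans_le (Fin.le_last i)).ne'
  have hγ := D.γ_Y i _ hi.symm
  rw [z]
  simp only [sub_mul, add_mul, mul_sub, mul_add, ← hp, hJ.eq, hγ.eq, (D.half_comm _).eq]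
  abel

theorem first_mul_Y_last :
    (D.p (Fin.last k) - D.half - D.γ (Fin.last k)) * D.Y (Fin.last k)
      = D.Y (Fin.last k) * (D.z (Fin.last k) - (D.half + D.half)) := by
  rw [z_last]
  simp only [sub_mul, mul_sub, mul_add, D.γ_Y_same, (D.half_comm _).eq, p, mul_assoc]
  abel

/-- The intertwiner `x_n τ` shifts the Dunkl–Opdam elements cyclically, up to `t`. -/
theorem z_mul_intertwiner_X (i : Fin (k + 1)) :
    D.z i * (D.X (Fin.last k) * D.sg (finRotate (k + 1))⁻¹)
      = D.X (Fin.last k) * D.sg (finRotate (k + 1))⁻¹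
        * (D.z (finRotate (k + 1) i) + if i = Fin.last k then D.half + D.half else 0) := by
  have hinv : D.sg (finRotate (k + 1))⁻¹ * D.sg (finRotate (k + 1)) = 1 := by
    rw [← map_mul, inv_mul_cancel, map_one]
  have hinv' : D.sg (finRotate (k + 1)) * D.sg (finRotate (k + 1))⁻¹ = 1 := by
    rw [← map_mul, mul_inv_cancel, map_one]
  have conj : ∀ a b : A, D.sg (finRotate (k + 1)) * a = b * D.sg (finRotate (k + 1)) →
      D.sg (finRotate (k + 1))⁻¹ * b = a * D.sg (finRotate (k + 1))⁻¹ := fun a b h => by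
    rw [← mul_one b, ← hinv', ← mul_assoc b, ← h, ← mul_assoc, ← mul_assoc, hinv, one_mul]
  split_ifs with hi
  · subst hi
    have h : D.sg (finRotate (k + 1)) * (D.p (Fin.last k) + D.half - D.γ (Fin.last k))
        = (D.z 0 + (D.half + D.half)) * D.sg (finRotate (k + 1)) := by
      rw [add_mul, ← D.sg_rotate_last, ((D.half_comm _).add_left (D.half_comm _)).eq, ← mul_add]
      congr 1
      abel
    rw [finRotate_last, mul_assoc, conj _ _ h, ← mul_assoc, ← mul_assoc, D.z_last_mul_X_last]
  · rw [add_zero, mul_assoc, conj _ _ (D.sg_rotate_z_add hi), ← mul_assoc, ← mul_assoc,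
      D.z_mul_X_last hi]

/-- The intertwiner `τ⁻¹ y_n` shifts the Dunkl–Opdam elements cyclically, up to `t`. -/
theorem z_mul_intertwiner_Y (i : Fin (k + 1)) :
    D.z (finRotate (k + 1) i) * (D.sg (finRotate (k + 1)) * D.Y (Fin.last k))
      = D.sg (finRotate (k + 1)) * D.Y (Fin.last k)
        * (D.z i - if i = Fin.last k then D.half + D.half else 0) := by
  split_ifs with hi
  · subst hi
    rw [finRotate_last, ← mul_assoc, ← D.sg_rotate_last, mul_assoc, D.first_mul_Y_last, mul_assoc]
  · rw [sub_zero, ← mul_assoc, ← D.sg_rotate_z_add hi, mul_assoc, D.z_add_mul_Y_last hi, mul_assoc]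

/-! ### Symmetric polynomials commute with σ, and with x_i and y_i once t maps to 0. -/

section Specialization

variable {K A' B : Type*} [CommRing K] [Ring A'] [Algebra K A'] [CommRing B] [Algebra K B]
  (φ : A →+* A') (ι : B →ₐ[K] A') (b : Fin (k + 1) → B) (hb : ∀ i, ι (b i) = φ (D.z i))
  {f : MvPolynomial (Fin (k + 1)) K} (hf : f.IsSymmetric)

include hb hf

theorem commute_sg_aeval (σ : Equiv.Perm (Fin (k + 1))) :
    Commute (φ (D.sg σ)) (ι (MvPolynomial.aeval b f)) := by
  have hσ : σ ∈ Submonoid.closure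
      (Set.range fun i : Fin k ↦ Equiv.swap i.castSucc i.succ) := by
    rw [Equiv.Perm.mclosure_swap_castSucc_succ]; trivial
  induction hσ using Submonoid.closure_induction with
  | mem σ hσ =>
    obtain ⟨i, rfl⟩ := hσ
    have hab : ∀ l : Fin (k + 1), l < i.succ ↔ l < i.castSucc ∨ l = i.castSucc := fun l => by
      rw [← le_iff_lt_or_eq, Fin.le_castSucc_iff]
    refine commute_aeval_of_pair ι b (Fin.castSucc_lt_succ (i := i)).ne ?_ ?_ ?_ hf
    · intro l h₁ h₂
      rw [hb]
      exact (D.sg_swap_z_of_ne hab h₁ h₂).map φ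
    · rw [hb, hb, ← map_add]
      exact (D.commute_sg_swap_add hab).map φ
    · rw [hb, hb, ← map_mul]
      exact (D.commute_sg_swap_mul hab).map φ
  | one => simp
  | mul σ τ _ _ h₁ h₂ =>
    rw [map_mul, map_mul]
    exact h₁.mul_left h₂

theorem commute_X_aeval (ht : φ (D.half + D.half) = 0) (i : Fin (k + 1)) :
    Commute (φ (D.X i)) (ι (MvPolynomial.aeval b f)) := by
  have h : Commute (φ (D.X (Fin.last k) * D.sg (finRotate (k + 1))⁻¹))
      (ι (MvPolynomial.aeval b f)) := by
    refine commute_aeval_of_perm ι b (finRotate (k + 1)) (fun l => ?_) hf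
    have := congrArg φ (D.z_mul_intertwiner_X l)
    rw [map_mul, map_mul _ _ (_ + _), map_add, apply_ite φ, ht, map_zero, ite_self,
      add_zero] at this
    rw [hb, hb, this]
  -- x_i = s (x_n τ⁻¹) (τ s⁻¹), where s swaps n and i.
  have hX : D.X i = D.sg (Equiv.swap (Fin.last k) i)
      * (D.X (Fin.last k) * D.sg (finRotate (k + 1))⁻¹)
      * D.sg (finRotate (k + 1) * (Equiv.swap (Fin.last k) i)⁻¹) := by
    rw [← mul_assoc, D.sg_X, Equiv.swap_apply_left, mul_assoc, mul_assoc, ← map_mul, ← map_mul]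
    simp
  rw [hX, map_mul, map_mul]
  exact ((D.commute_sg_aeval φ ι b hb hf _).mul_left h).mul_left (D.commute_sg_aeval φ ι b hb hf _)

theorem commute_Y_aeval (ht : φ (D.half + D.half) = 0) (i : Fin (k + 1)) :
    Commute (φ (D.Y i)) (ι (MvPolynomial.aeval b f)) := by
  have h : Commute (φ (D.sg (finRotate (k + 1)) * D.Y (Fin.last k)))
      (ι (MvPolynomial.aeval b f)) := by
    refine commute_aeval_of_perm ι b (finRotate (k + 1)).symm (fun l => ?_) hf
    have := congrArg φ (D.z_mul_intertwiner_Y ((finRotate (k + 1)).symm l))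
    rw [map_mul, map_mul _ _ (_ - _), map_sub, apply_ite φ, ht, map_zero, ite_self,
      sub_zero, Equiv.apply_symm_apply] at this
    rw [hb, hb, this]
  have hY : D.Y i = D.sg (Equiv.swap (Fin.last k) i * (finRotate (k + 1))⁻¹)
      * (D.sg (finRotate (k + 1)) * D.Y (Fin.last k))
      * D.sg (Equiv.swap (Fin.last k) i)⁻¹ := by
    rw [← mul_assoc, ← map_mul, inv_mul_cancel_right, D.sg_Y, Equiv.swap_apply_left, mul_assoc,
      ← map_mul]
    simp
  rw [hY, map_mul, map_mul]
  exact ((D.commute_sg_aeval φ ι b hb hf _).mul_left h).mul_left (D.commute_sg_aeval φ ι b hb hf _)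

end Specialization

end Rotate

end DunklOpdamData

end Cherednik

noncomputable section

namespace Cherednik

/-! ### The group `G(m,1,n)` -/

section Group

variable {m n : ℕ}

theorem g_commute (i j : Fin n) : Commute (g m n i) (g m n j) := by
  rw [g, g, commute_iff_eq, ← map_mul, ← map_mul, mul_comm]

theorem g_pow_card (i : Fin n) : g m n i ^ m = 1 := by
  rw [g, ← map_pow, ← Pi.mulSingle_pow, ← ofAdd_nsmul]
  simp

theorem perm_mul_g (σ : Equiv.Perm (Fin n)) (i : Fin n) :
    perm m n σ * g m n i = g m n (σ i) * perm m n σ := by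
  have h : (mulAutArrow σ) (Pi.mulSingle i (Multiplicative.ofAdd (1 : ZMod m)))
      = Pi.mulSingle (σ i) (Multiplicative.ofAdd (1 : ZMod m)) := by
    funext j
    change (Pi.mulSingle i (Multiplicative.ofAdd (1 : ZMod m)) : Fin n → _) (σ⁻¹ • j) = _
    simp only [Equiv.Perm.smul_def, Pi.mulSingle_apply, Equiv.Perm.inv_eq_iff_eq]
  rw [g, g, perm, ← h, SemidirectProduct.inl_aut]
  simp

/-- `G(m,1,n)` is generated by the `g_i` and the permutations. -/
theorem induction_on_g_perm (hm : 0 < m) {C : G m n → Prop} (hg : ∀ i, C (g m n i))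
    (hperm : ∀ σ, C (perm m n σ)) (hmul : ∀ v w, C v → C w → C (v * w)) (w : G m n) : C w := by
  have : NeZero m := ⟨hm.ne'⟩
  have hone : C 1 := by simpa [perm] using hperm 1
  have hpow : ∀ i (l : ℕ), C (g m n i ^ l) := fun i l => by
    induction l with
    | zero => simpa using hone
    | succ l ih => rw [pow_succ]; exact hmul _ _ ih (hg i)
  have hsingle : ∀ i (a : Multiplicative (ZMod m)),
      C (SemidirectProduct.inl (Pi.mulSingle i a)) := fun i a => by
    have h := hpow i (Multiplicative.toAdd a).val
    rw [g, ← map_pow, ← Pi.mulSingle_pow, ← ofAdd_nsmul] at h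
    simpa using h
  have hinl : ∀ (f : Fin n → Multiplicative (ZMod m)) (s : Finset (Fin n)),
      C (SemidirectProduct.inl (∏ i ∈ s, Pi.mulSingle i (f i))) := fun f s => by
    induction s using Finset.induction_on with
    | empty => simpa using hone
    | insert a s ha ih =>
      rw [Finset.prod_insert ha, map_mul]
      exact hmul _ _ (hsingle _ _) ih
  rw [← SemidirectProduct.inl_left_mul_inr_right w]
  refine hmul _ _ ?_ (hperm _)
  have := hinl w.left Finset.univ
  rwa [Finset.univ_prod_mulSingle] at this

theorem sum_range_pow_succ {Γ M : Type*} [Group Γ] [AddCommMonoid M] (f : Γ → M) {u : Γ} {m : ℕ}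
    (hu : u ^ m = 1) :
    ∑ l ∈ Finset.range m, f (u ^ (l + 1)) = ∑ l ∈ Finset.range m, f (u ^ l) := by
  cases m with
  | zero => simp
  | succ k => rw [Finset.sum_range_succ, Finset.sum_range_succ', hu, pow_zero]

theorem sum_range_inv_pow {Γ M : Type*} [Group Γ] [AddCommMonoid M] (f : Γ → M) {u : Γ} {m : ℕ}
    (hu : u ^ m = 1) :
    ∑ l ∈ Finset.range m, f (u⁻¹ ^ l) = ∑ l ∈ Finset.range m, f (u ^ l) := by
  -- After the shift by one, the reflection l ↦ m − 1 − l pairs exponents that add up to m.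
  rw [← sum_range_pow_succ f hu, ← Finset.sum_range_reflect]
  refine Finset.sum_congr rfl fun l hl => ?_
  have hl' := Finset.mem_range.1 hl
  congr 1
  rw [inv_pow, inv_eq_iff_mul_eq_one, ← pow_add, ← hu]
  congr 1
  omega

end Group

/-! ### Relations in the rational Cherednik algebra -/

section Relations

variable {m n : ℕ} {η : ℂ}

theorem mk_eq_of_rel {a b : F m n} (h : Rel m n η a b) : mk m n η a = mk m n η b :=
  RingQuot.mkAlgHom_rel _ h

variable (m n η) in
/-- The map from `G(m,1,n)` to the rational Cherednik algebra. -/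
def grpHom : G m n →* H m n η where
  toFun := grp m n η
  map_one' := (mk_eq_of_rel Rel.one).trans (map_one _)
  map_mul' v w := (mk_eq_of_rel (Rel.mul v w)).trans (map_mul _ _ _)

theorem grp_eq (w : G m n) : grp m n η w = grpHom m n η w := rfl

theorem grpHom_inv_mul (w : G m n) : grpHom m n η w⁻¹ * grpHom m n η w = 1 := by
  rw [← map_mul, inv_mul_cancel, map_one]

theorem grpHom_mul_inv (w : G m n) : grpHom m n η w * grpHom m n η w⁻¹ = 1 := by
  rw [← map_mul, mul_inv_cancel, map_one]

theorem perm_y (σ : Equiv.Perm (Fin n)) (j : Fin n) :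
    grpHom m n η (perm m n σ) * y m n η j = y m n η (σ j) * grpHom m n η (perm m n σ) := by
  have h := mk_eq_of_rel (η := η) (Rel.perm_y (m := m) σ j)
  rwa [map_mul, map_mul] at h

theorem perm_x (σ : Equiv.Perm (Fin n)) (j : Fin n) :
    grpHom m n η (perm m n σ) * x m n η j = x m n η (σ j) * grpHom m n η (perm m n σ) := by
  have h := mk_eq_of_rel (η := η) (Rel.perm_x (m := m) σ j)
  rwa [map_mul, map_mul] at h

theorem g_y_same (i : Fin n) : grpHom m n η (g m n i) * y m n η i
    = (MvPolynomial.C η : R m) • (y m n η i * grpHom m n η (g m n i)) := by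
  have h := mk_eq_of_rel (η := η) (Rel.g_y (m := m) i i)
  rwa [map_mul, map_smul, map_mul, if_pos rfl] at h

theorem g_x_same (i : Fin n) : grpHom m n η (g m n i) * x m n η i
    = (MvPolynomial.C η⁻¹ : R m) • (x m n η i * grpHom m n η (g m n i)) := by
  have h := mk_eq_of_rel (η := η) (Rel.g_x (m := m) i i)
  rwa [map_mul, map_smul, map_mul, if_pos rfl] at h

theorem commute_g_y {i j : Fin n} (hij : i ≠ j) :
    Commute (grpHom m n η (g m n i)) (y m n η j) := by
  have h := mk_eq_of_rel (η := η) (Rel.g_y (m := m) i j)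
  rwa [map_mul, map_smul, map_mul, if_neg hij, map_one, one_smul] at h

theorem commute_g_x {i j : Fin n} (hij : i ≠ j) :
    Commute (grpHom m n η (g m n i)) (x m n η j) := by
  have h := mk_eq_of_rel (η := η) (Rel.g_x (m := m) i j)
  rwa [map_mul, map_smul, map_mul, if_neg hij, map_one, one_smul] at h

theorem commute_x_x (i j : Fin n) : Commute (x m n η i) (x m n η j) := by
  have h := mk_eq_of_rel (η := η) (Rel.x_x (m := m) i j)
  rwa [map_mul, map_mul] at h

theorem commute_y_y (i j : Fin n) : Commute (y m n η i) (y m n η j) := by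
  have h := mk_eq_of_rel (η := η) (Rel.y_y (m := m) i j)
  rwa [map_mul, map_mul] at h

theorem commute_g_yx (hη : η ≠ 0) (i j : Fin n) :
    Commute (grpHom m n η (g m n i)) (y m n η j * x m n η j) := by
  by_cases hij : i = j
  · subst hij
    rw [commute_iff_eq, ← mul_assoc, g_y_same, smul_mul_assoc, mul_assoc, g_x_same,
      mul_smul_comm, smul_smul, ← map_mul, mul_inv_cancel₀ hη, map_one, one_smul, mul_assoc]
  · exact (commute_g_y hij).mul_right (commute_g_x hij)

theorem pow_mul_of_mul {A K : Type*} [CommRing K] [Ring A] [Algebra K A] {u v : A} {a : K}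
    (h : u * v = a • (v * u)) (l : ℕ) : u ^ l * v = a ^ l • (v * u ^ l) := by
  induction l with
  | zero => simp
  | succ l ih =>
    rw [pow_succ, mul_assoc, h, mul_smul_comm, ← mul_assoc, ih, smul_mul_assoc, smul_smul,
      mul_assoc, pow_succ, mul_comm]

theorem inv_mul_of_mul {A K : Type*} [CommRing K] [Ring A] [Algebra K A] {u u' v : A} {a a' : K}
    (hu : u' * u = 1) (hu' : u * u' = 1) (ha : a' * a = 1) (h : u * v = a • (v * u)) :
    u' * v = a' • (v * u') := by
  have h' : u' * (a • (v * u)) * u' = v * u' := by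
    rw [← h, ← mul_assoc, hu, one_mul]
  rw [← h', mul_smul_comm, smul_mul_assoc, smul_smul, ha, one_smul, mul_assoc, mul_assoc, hu',
    mul_one]

theorem g_pow_x (i : Fin n) (l : ℕ) : grpHom m n η (g m n i ^ l) * x m n η i
    = (MvPolynomial.C (η⁻¹ ^ l) : R m) • (x m n η i * grpHom m n η (g m n i ^ l)) := by
  rw [map_pow, map_pow]
  exact pow_mul_of_mul (A := H m n η) (g_x_same i) l

theorem g_pow_y (i : Fin n) (l : ℕ) : grpHom m n η (g m n i ^ l) * y m n η i
    = (MvPolynomial.C (η ^ l) : R m) • (y m n η i * grpHom m n η (g m n i ^ l)) := by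
  rw [map_pow, map_pow]
  exact pow_mul_of_mul (A := H m n η) (g_y_same i) l

theorem g_inv_pow_x (hη : η ≠ 0) (i : Fin n) (l : ℕ) :
    grpHom m n η ((g m n i)⁻¹ ^ l) * x m n η i
      = (MvPolynomial.C (η ^ l) : R m) • (x m n η i * grpHom m n η ((g m n i)⁻¹ ^ l)) := by
  rw [map_pow, map_pow]
  refine pow_mul_of_mul (A := H m n η) (inv_mul_of_mul (A := H m n η) (grpHom_inv_mul _) (grpHom_mul_inv _) ?_ (g_x_same i)) l
  rw [← map_mul, mul_inv_cancel₀ hη, map_one]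

theorem g_inv_pow_y (hη : η ≠ 0) (i : Fin n) (l : ℕ) :
    grpHom m n η ((g m n i)⁻¹ ^ l) * y m n η i
      = (MvPolynomial.C (η⁻¹ ^ l) : R m) • (y m n η i * grpHom m n η ((g m n i)⁻¹ ^ l)) := by
  rw [map_pow, map_pow]
  refine pow_mul_of_mul (A := H m n η) (inv_mul_of_mul (A := H m n η) (grpHom_inv_mul _) (grpHom_mul_inv _) ?_ (g_y_same i)) l
  rw [← map_mul, inv_mul_cancel₀ hη, map_one]

theorem commute_grpHom_inv {w : G m n} {a : H m n η} (h : Commute (grpHom m n η w) a) :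
    Commute (grpHom m n η w⁻¹) a := by
  have h' : grpHom m n η w * a = (1 : R m) • (a * grpHom m n η w) := by rw [one_smul, h.eq]
  have := inv_mul_of_mul (A := H m n η) (grpHom_inv_mul w) (grpHom_mul_inv w) (one_mul 1) h'
  rwa [one_smul] at this

variable (m n η)

/-- `κ ∑ g_i^l g_j^{-l}`. -/
def elE (i j : Fin n) : H m n η :=
  kappaR m • ∑ l ∈ Finset.range m, grpHom m n η (g m n i ^ l * (g m n j)⁻¹ ^ l)

/-- `∑ c_l η^{-l} g_i^l`. -/
def elγ (i : Fin n) : H m n η :=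
  ∑ l : Fin (m - 1), (cR m l * MvPolynomial.C (η⁻¹ ^ ((l : ℕ) + 1))) •
    grpHom m n η (g m n i ^ ((l : ℕ) + 1))

/-- `∑ c_l g_i^l`. -/
def elψ (i : Fin n) : H m n η :=
  ∑ l : Fin (m - 1), cR m l • grpHom m n η (g m n i ^ ((l : ℕ) + 1))

/-- `κ ∑ η^{-l} s_{ij} g_i^{-l} g_j^l`. -/
def elQ (i j : Fin n) : H m n η :=
  kappaR m • ∑ l ∈ Finset.range m, (MvPolynomial.C (η⁻¹ ^ l) : R m) •
    grpHom m n η (s m n i j * (g m n i)⁻¹ ^ l * g m n j ^ l)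

/-- `t / 2`. -/
def elHalf : H m n η := (MvPolynomial.C (1 / 2) * tR m) • (1 : H m n η)

/-- The map from `S_n` to the rational Cherednik algebra. -/
def permHom : Equiv.Perm (Fin n) →* H m n η := (grpHom m n η).comp SemidirectProduct.inr

variable {m n η}

theorem permHom_apply (σ : Equiv.Perm (Fin n)) :
    permHom m n η σ = grpHom m n η (perm m n σ) := rfl

theorem permHom_mul_g (σ : Equiv.Perm (Fin n)) (i : Fin n) :
    permHom m n η σ * grpHom m n η (g m n i) = grpHom m n η (g m n (σ i)) * permHom m n η σ := by
  rw [permHom_apply, ← map_mul, perm_mul_g, map_mul]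

theorem elHalf_add_elHalf : elHalf m n η + elHalf m n η = tR m • (1 : H m n η) := by
  rw [elHalf, ← add_smul, ← add_mul, ← map_add]
  norm_num

theorem g_mul_inv_pow_card (i j : Fin n) : (g m n i * (g m n j)⁻¹) ^ m = 1 := by
  rw [((g_commute i j).inv_right).mul_pow, inv_pow, g_pow_card, g_pow_card, inv_one, one_mul]

theorem elE_eq (i j : Fin n) : elE m n η i j
    = kappaR m • ∑ l ∈ Finset.range m, grpHom m n η ((g m n i * (g m n j)⁻¹) ^ l) := by
  simp only [elE, ((g_commute i j).inv_right).mul_pow]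

theorem elE_eq_inv (i j : Fin n) : elE m n η i j
    = kappaR m • ∑ l ∈ Finset.range m, grpHom m n η ((g m n i)⁻¹ ^ l * g m n j ^ l) := by
  rw [elE_eq, ← sum_range_inv_pow _ (g_mul_inv_pow_card i j)]
  have h : (g m n i * (g m n j)⁻¹)⁻¹ = (g m n i)⁻¹ * g m n j := by
    rw [mul_inv_rev, inv_inv, ((g_commute i j).inv_left).eq]
  simp only [h, ((g_commute i j).inv_left).mul_pow]

theorem elE_symm (i j : Fin n) : elE m n η i j = elE m n η j i := by
  rw [elE, elE_eq_inv j i]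
  simp only [(((g_commute i j).inv_right).pow_pow _ _).eq]

theorem commute_elE {a : H m n η} {i j : Fin n} (hi : Commute (grpHom m n η (g m n i)) a)
    (hj : Commute (grpHom m n η (g m n j)) a) : Commute (elE m n η i j) a := by
  have h : Commute (∑ l ∈ Finset.range m, grpHom m n η (g m n i ^ l * (g m n j)⁻¹ ^ l)) a :=
    Commute.sum_left _ _ _ fun l _ => by
      rw [map_mul, map_pow, map_pow]
      exact (hi.pow_left l).mul_left ((commute_grpHom_inv hj).pow_left l)
  exact h.smul_left (kappaR m)

theorem commute_elγ {a : H m n η} {i : Fin n} (hi : Commute (grpHom m n η (g m n i)) a) :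
    Commute (elγ m n η i) a := by
  refine Commute.sum_left _ _ _ fun l _ => ?_
  rw [map_pow (grpHom m n η)]
  exact (hi.pow_left _).smul_left (cR m l * MvPolynomial.C (η⁻¹ ^ ((l : ℕ) + 1)))

theorem commute_g_g (i j : Fin n) :
    Commute (grpHom m n η (g m n i)) (grpHom m n η (g m n j)) := (g_commute i j).map _

theorem commute_g_elE (i j k : Fin n) : Commute (grpHom m n η (g m n k)) (elE m n η i j) :=
  (commute_elE (commute_g_g i k) (commute_g_g j k)).symm

/-- `elE i j` is a multiple of the sum of all powers of g_i g_j⁻¹, so it absorbs that element. -/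
theorem g_mul_elE (i j : Fin n) :
    grpHom m n η (g m n i) * elE m n η i j = grpHom m n η (g m n j) * elE m n η i j := by
  rw [elE_eq, mul_smul_comm, mul_smul_comm, Finset.mul_sum, Finset.mul_sum]
  congr 1
  simp only [← map_mul]
  rw [← sum_range_pow_succ (fun v => grpHom m n η (g m n j * v)) (g_mul_inv_pow_card i j)]
  refine Finset.sum_congr rfl fun l _ => ?_
  rw [pow_succ', ← mul_assoc, ← mul_assoc, (g_commute j i).eq, mul_inv_cancel_right]

/-- The swap exchanges g_i and g_j, and `elE i j` does not distinguish them. -/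
theorem commute_g_P (i j k : Fin n) :
    Commute (grpHom m n η (g m n k)) (permHom m n η (Equiv.swap i j) * elE m n η i j) := by
  have h := permHom_mul_g (η := η) (m := m) (Equiv.swap i j) (Equiv.swap i j k)
  rw [Equiv.swap_apply_self] at h
  have h' : grpHom m n η (g m n (Equiv.swap i j k)) * elE m n η i j
      = grpHom m n η (g m n k) * elE m n η i j := by
    rw [Equiv.swap_apply_def]
    split_ifs with h₁ h₂
    · rw [h₁, g_mul_elE]
    · rw [h₂, g_mul_elE]
    · rfl
  rw [commute_iff_eq, ← mul_assoc, ← h, mul_assoc, h', (commute_g_elE i j k).eq, mul_assoc]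

theorem permHom_elE (σ : Equiv.Perm (Fin n)) (i j : Fin n) :
    permHom m n η σ * elE m n η i j = elE m n η (σ i) (σ j) * permHom m n η σ := by
  have hg : ∀ i, SemiconjBy (perm m n σ) (g m n i) (g m n (σ i)) := perm_mul_g σ
  rw [elE, elE, mul_smul_comm, smul_mul_assoc, Finset.mul_sum, Finset.sum_mul]
  simp only [permHom_apply, ← map_mul]
  congr 1
  refine Finset.sum_congr rfl fun l _ => congrArg _ ?_
  exact ((hg i).pow_right l).mul_right ((hg j).inv_right.pow_right l)

theorem permHom_elγ (σ : Equiv.Perm (Fin n)) (i : Fin n) :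
    permHom m n η σ * elγ m n η i = elγ m n η (σ i) * permHom m n η σ := by
  have hg : ∀ i, SemiconjBy (perm m n σ) (g m n i) (g m n (σ i)) := perm_mul_g σ
  rw [elγ, elγ, Finset.mul_sum, Finset.sum_mul]
  refine Finset.sum_congr rfl fun l _ => ?_
  rw [mul_smul_comm, smul_mul_assoc, permHom_apply, ← map_mul, ((hg i).pow_right _).eq, map_mul]

/-- Passing x_i costs g_i^l the factor η^{-l}, precisely the ratio of the weights in `elγ` and
`elψ`. -/
theorem elψ_x (i : Fin n) : elψ m n η i * x m n η i = x m n η i * elγ m n η i := by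
  rw [elψ, elγ, Finset.mul_sum, Finset.sum_mul]
  refine Finset.sum_congr rfl fun l _ => ?_
  rw [smul_mul_assoc, g_pow_x, smul_smul, mul_smul_comm]

theorem elγ_y (hη : η ≠ 0) (i : Fin n) : elγ m n η i * y m n η i = y m n η i * elψ m n η i := by
  rw [elψ, elγ, Finset.mul_sum, Finset.sum_mul]
  refine Finset.sum_congr rfl fun l _ => ?_
  rw [smul_mul_assoc, g_pow_y, smul_smul, mul_smul_comm, mul_assoc, ← map_mul, ← mul_pow,
    inv_mul_cancel₀ hη, one_pow, map_one, mul_one]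

/-- The factor η^l from moving g_i^{-l} past x_i cancels the weight η^{-l} in `elQ`. -/
theorem elQ_x (hη : η ≠ 0) {i j : Fin n} (hij : i ≠ j) : elQ m n η i j * x m n η i
    = x m n η j * (permHom m n η (Equiv.swap i j) * elE m n η i j) := by
  rw [elQ, elE_eq_inv, smul_mul_assoc, mul_smul_comm, mul_smul_comm, Finset.sum_mul,
    Finset.mul_sum, Finset.mul_sum]
  congr 1
  refine Finset.sum_congr rfl fun l _ => ?_
  have hx := perm_x (m := m) (η := η) (Equiv.swap i j) i
  rw [Equiv.swap_apply_left] at hx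
  rw [smul_mul_assoc, mul_assoc (s m n i j), map_mul, s, mul_assoc, map_mul, mul_assoc,
    map_pow _ (g m n j), ((commute_g_x hij.symm).pow_left l).eq, ← mul_assoc _ (x m n η i),
    g_inv_pow_x hη, smul_mul_assoc, mul_smul_comm, smul_smul, ← map_mul, ← mul_pow,
    inv_mul_cancel₀ hη, one_pow, map_one, one_smul, permHom_apply, ← mul_assoc, ← mul_assoc,
    hx]
  simp only [mul_assoc]

theorem y_elQ (hη : η ≠ 0) {i j : Fin n} (hij : i ≠ j) : y m n η j * elQ m n η i j
    = permHom m n η (Equiv.swap i j) * elE m n η i j * y m n η i := by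
  rw [elQ, elE_eq_inv, mul_smul_comm, mul_smul_comm, smul_mul_assoc, Finset.mul_sum,
    Finset.mul_sum, Finset.sum_mul]
  congr 1
  refine Finset.sum_congr rfl fun l _ => ?_
  have hy := perm_y (m := m) (η := η) (Equiv.swap i j) i
  rw [Equiv.swap_apply_left] at hy
  rw [mul_smul_comm, mul_assoc (s m n i j), map_mul, s, ← mul_assoc, ← hy, map_mul _ (_ ^ _),
    mul_assoc (permHom _ _ _ _), mul_assoc _ _ (y m n η i), map_pow _ (g m n j),
    ((commute_g_y hij.symm).pow_left l).eq, ← mul_assoc _ (y m n η i),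
    g_inv_pow_y hη, smul_mul_assoc, mul_smul_comm, permHom_apply]
  simp only [mul_assoc]

theorem y_x_diff {i j : Fin n} (hij : i ≠ j) :
    y m n η i * x m n η j = x m n η j * y m n η i + elQ m n η i j := by
  have h := mk_eq_of_rel (η := η) (Rel.y_x_diff (m := m) i j hij)
  rw [map_sub, map_mul, map_mul, map_smul, map_sum, sub_eq_iff_eq_add'] at h
  simp only [map_smul] at h
  exact h

theorem y_x_same (i : Fin n) : y m n η i * x m n η i
    = x m n η i * y m n η i + (elHalf m n η + elHalf m n η)
      - ∑ j ∈ Finset.univ.filter (fun j => j ≠ i), permHom m n η (Equiv.swap i j) * elE m n η i j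
      + elγ m n η i - elψ m n η i := by
  have h := mk_eq_of_rel (η := η) (Rel.y_x_same (m := m) i)
  rw [map_sub, map_mul, map_mul, map_sub, map_sub, map_smul, map_one, map_smul, map_sum,
    map_sum, sub_eq_iff_eq_add'] at h
  simp only [map_smul, map_sum] at h
  rw [Finset.sum_comm] at h
  have hP : kappaR m • ∑ j ∈ Finset.univ.filter (fun j => j ≠ i), ∑ l ∈ Finset.range m,
      mk m n η (fw m n (s m n i j * (g m n i)⁻¹ ^ l * g m n j ^ l))
      = ∑ j ∈ Finset.univ.filter (fun j => j ≠ i),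
          permHom m n η (Equiv.swap i j) * elE m n η i j := by
    rw [Finset.smul_sum]
    refine Finset.sum_congr rfl fun j _ => ?_
    rw [elE_eq_inv, mul_smul_comm, Finset.mul_sum]
    congr 1
    refine Finset.sum_congr rfl fun l _ => ?_
    rw [permHom_apply, ← map_mul, ← mul_assoc]
    rfl
  -- Splitting 1 − η^{-l} separates the reflection term into its `elψ` and `elγ` parts.
  have hc : ∑ l : Fin (m - 1), (cR m l * MvPolynomial.C (1 - η⁻¹ ^ ((l : ℕ) + 1))) •
      mk m n η (fw m n (g m n i ^ ((l : ℕ) + 1))) = elψ m n η i - elγ m n η i := by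
    have hadd : ∑ l : Fin (m - 1), (cR m l * MvPolynomial.C (1 - η⁻¹ ^ ((l : ℕ) + 1))) •
        mk m n η (fw m n (g m n i ^ ((l : ℕ) + 1))) + elγ m n η i = elψ m n η i := by
      rw [elψ, elγ, ← Finset.sum_add_distrib]
      refine Finset.sum_congr rfl fun l _ => ?_
      rw [← grp_eq, grp, ← add_smul, ← mul_add, ← map_add, sub_add_cancel, map_one, mul_one]
    rw [← hadd]
    abel
  rw [hP, hc, ← elHalf_add_elHalf] at h
  refine Eq.trans h ?_
  simp only [x, y]
  abel

variable (m n) in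
/-- The relations of the rational Cherednik algebra of `G(m,1,n)`. -/
def dunklOpdamData (hη : η ≠ 0) : DunklOpdamData n (H m n η) where
  X := x m n η
  Y := y m n η
  γ := elγ m n η
  ψ := elψ m n η
  E := elE m n η
  Q := elQ m n η
  half := elHalf m n η
  sg := permHom m n η
  half_comm a := (Commute.one_left a).smul_left _
  sg_X := perm_x
  sg_Y := perm_y
  sg_γ := permHom_elγ
  sg_E := permHom_elE
  X_comm := commute_x_x
  Y_comm := commute_y_y
  E_symm := elE_symm
  E_X _ _ _ hi hj := commute_elE (commute_g_x hi.symm) (commute_g_x hj.symm)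
  E_Y _ _ _ hi hj := commute_elE (commute_g_y hi.symm) (commute_g_y hj.symm)
  E_YX _ _ _ := commute_elE (commute_g_yx hη _ _) (commute_g_yx hη _ _)
  E_sg_E _ _ _ _ := commute_elE (commute_g_P _ _ _) (commute_g_P _ _ _)
  E_γ _ _ _ := commute_elE (commute_elγ (commute_g_g _ _)).symm (commute_elγ (commute_g_g _ _)).symm
  γ_X _ _ h := commute_elγ (commute_g_x h.symm)
  γ_Y _ _ h := commute_elγ (commute_g_y h.symm)
  γ_YX _ _ := commute_elγ (commute_g_yx hη _ _)
  γ_sg_E _ _ _ := commute_elγ (commute_g_P _ _ _)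
  γ_γ _ _ := commute_elγ (commute_elγ (commute_g_g _ _)).symm
  ψ_X := elψ_x
  γ_Y_same := elγ_y hη
  Q_X _ _ := elQ_x hη
  Y_Q _ _ := y_elQ hη
  yx_same := y_x_same
  yx_diff _ _ := y_x_diff

theorem dunklOpdamData_z (hη : η ≠ 0) (i : Fin n) :
    (dunklOpdamData m n hη).z i = z m n η i := by
  have hJ : (dunklOpdamData m n hη).J i = kappaR m • ∑ l ∈ Finset.range m,
      ∑ j ∈ Finset.univ.filter (fun j => j < i),
        grp m n η (s m n i j * g m n i ^ l * (g m n j)⁻¹ ^ l) := by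
    rw [Finset.sum_comm, Finset.smul_sum, DunklOpdamData.J]
    refine Finset.sum_congr rfl fun j _ => ?_
    change permHom m n η (Equiv.swap i j) * elE m n η i j = _
    rw [elE, mul_smul_comm, Finset.mul_sum]
    congr 1
    refine Finset.sum_congr rfl fun l _ => ?_
    rw [permHom_apply, ← map_mul, ← mul_assoc]
    rfl
  rw [DunklOpdamData.z, hJ]
  rfl

theorem commute_g_z (hη : η ≠ 0) (i j : Fin n) :
    Commute (grpHom m n η (g m n i)) (z m n η j) := by
  rw [← dunklOpdamData_z hη, DunklOpdamData.z_eq]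
  have hJ : Commute (grpHom m n η (g m n i)) ((dunklOpdamData m n hη).J j) :=
    Commute.sum_right _ _ _ fun k _ => commute_g_P j k i
  have hp : Commute (grpHom m n η (g m n i)) ((dunklOpdamData m n hη).p j) := commute_g_yx hη i j
  have hγ : Commute (grpHom m n η (g m n i)) ((dunklOpdamData m n hη).γ j) :=
    (commute_elγ (commute_g_g j i)).symm
  exact Commute.sub_right (R := H m n η) (hp.add_right hJ) (((dunklOpdamData m n hη).half_comm _).symm.add_right hγ)

theorem commute_z (hη : η ≠ 0) (i j : Fin n) : Commute (z m n η i) (z m n η j) := by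
  rw [← dunklOpdamData_z hη, ← dunklOpdamData_z hη]
  exact (dunklOpdamData m n hη).commute_z i j

/-- The rational Cherednik algebra is generated by the `x_i`, the `y_i`, the `g_i` and the
permutations. -/
theorem H_induction (hm : 0 < m) {C : H m n η → Prop} (halg : ∀ r, C (algebraMap (R m) _ r))
    (hx : ∀ i, C (x m n η i)) (hy : ∀ i, C (y m n η i)) (hg : ∀ i, C (grpHom m n η (g m n i)))
    (hperm : ∀ σ, C (permHom m n η σ)) (hmul : ∀ a b, C a → C b → C (a * b))
    (hadd : ∀ a b, C a → C b → C (a + b)) (a : H m n η) : C a := by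
  obtain ⟨f, rfl⟩ := RingQuot.mkAlgHom_surjective (R m) (Rel m n η) a
  induction f using FreeAlgebra.induction with
  | grade0 r => rw [AlgHom.commutes]; exact halg r
  | grade1 v =>
    cases v with
    | x i => exact hx i
    | y i => exact hy i
    | w w =>
      refine induction_on_g_perm (C := fun w => C (grpHom m n η w)) hm hg hperm ?_ w
      intro v w hv hw
      rw [map_mul]
      exact hmul _ _ hv hw
  | mul a b ha hb => rw [map_mul]; exact hmul _ _ ha hb
  | add a b ha hb => rw [map_add]; exact hadd _ _ ha hb

end Relations

end Cherednik

end

noncomputable section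

namespace Cherednik

/-! ### Central elements at `t = 0` -/

open scoped IsMulCommutative in
/-- Commuting elements of an algebra lie in the image of a commutative algebra. -/
theorem exists_commRing_lift {n : ℕ} (K : Type) {A : Type} [CommRing K] [Ring A] [Algebra K A]
    (a : Fin n → A) (ha : ∀ i j, Commute (a i) (a j)) :
    ∃ (B : Type) (_ : CommRing B) (_ : Algebra K B) (ι : B →ₐ[K] A) (b : Fin n → B),
      ∀ i, ι (b i) = a i := by
  have hcomm : ∀ u ∈ Set.range a, ∀ v ∈ Set.range a, u * v = v * u := by
    rintro _ ⟨i, rfl⟩ _ ⟨j, rfl⟩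
    exact ha i j
  have := Algebra.isMulCommutative_adjoin K hcomm
  exact ⟨Algebra.adjoin K (Set.range a), inferInstance, inferInstance,
    (Algebra.adjoin K (Set.range a)).val,
    fun i => ⟨a i, Algebra.subset_adjoin (Set.mem_range_self i)⟩, fun _ => rfl⟩

/-! ### Centrality in an arbitrary quotient killing t. -/

section Quotient

variable {m n : ℕ} {η : ℂ} {A : Type} [Ring A] (φ : H m n η →+* A)

theorem map_S (r : ℕ) : φ (S m n η r)
    = ∑ J ∈ Finset.powersetCard r (Finset.univ : Finset (Fin n)),
        ((Finset.sort J (· ≤ ·)).map fun i => φ (z m n η i)).prod := by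
  rw [S, map_sum]
  refine Finset.sum_congr rfl fun J _ => ?_
  rw [map_list_prod, List.map_map]
  rfl

variable (hm : 0 < m) (hn : 0 < n) (hη : η ≠ 0) (hφ : Function.Surjective φ) (ht : φ (tR m • 1) = 0)

include hm hn hη hφ ht

/-- In a quotient of the rational Cherednik algebra in which `t = 0`, the symmetric polynomials in
the Dunkl–Opdam elements are central. -/
theorem aeval_mem_center {K B : Type*} [CommRing K] [Algebra K A] [CommRing B] [Algebra K B]
    (ι : B →ₐ[K] A) (b : Fin n → B) (hb : ∀ i, ι (b i) = φ (z m n η i))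
    {f : MvPolynomial (Fin n) K} (hf : f.IsSymmetric) :
    ι (MvPolynomial.aeval b f) ∈ Subring.center A := by
  obtain ⟨k, rfl⟩ := Nat.exists_eq_succ_of_ne_zero hn.ne'
  set u := ι (MvPolynomial.aeval b f)
  have ht' : φ ((dunklOpdamData m (k + 1) hη).half + (dunklOpdamData m (k + 1) hη).half) = 0 := by
    rw [← ht, ← elHalf_add_elHalf]
    rfl
  have hb' : ∀ i, ι (b i) = φ ((dunklOpdamData m (k + 1) hη).z i) := fun i => by
    rw [hb, dunklOpdamData_z]
  have key : ∀ a : H m (k + 1) η, Commute (φ a) u := by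
    refine H_induction hm (fun r => ?_) (fun i => ?_) (fun i => ?_) (fun i => ?_) (fun σ => ?_)
      (fun a b ha hb => ?_) (fun a b ha hb => ?_)
    -- `A` carries no `R m`-algebra structure, so u is lifted to H_R, where scalars are central.
    · obtain ⟨v, hv⟩ := hφ u
      have h : Commute (algebraMap (R m) (H m (k + 1) η) r) v := Algebra.commutes r v
      rw [← hv]
      exact h.map φ
    · exact (dunklOpdamData m (k + 1) hη).commute_X_aeval φ ι b hb' hf ht' i
    · exact (dunklOpdamData m (k + 1) hη).commute_Y_aeval φ ι b hb' hf ht' i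
    · refine commute_aeval_of_perm ι b 1 (fun l => ?_) hf
      rw [Equiv.Perm.one_apply, hb]
      exact ((commute_g_z hη i l).map φ).eq.symm
    · exact (dunklOpdamData m (k + 1) hη).commute_sg_aeval φ ι b hb' hf σ
    · rw [map_mul]
      exact ha.mul_left hb
    · rw [map_add]
      exact ha.add_left hb
  rw [Subring.mem_center_iff]
  intro a
  obtain ⟨a, rfl⟩ := hφ a
  exact (key a).eq

theorem map_S_mem_center (r : ℕ) : φ (S m n η r) ∈ Subring.center A := by
  -- `A` is only a ring here, and integer coefficients suffice for elementary symmetric polynomials.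
  obtain ⟨B, _, _, ι, b, hb⟩ := exists_commRing_lift ℤ (fun i => φ (z m n η i))
    fun i j => (commute_z hη i j).map φ
  rw [map_S]
  simp only [← hb]
  rw [orderedEsymm_eq]
  exact aeval_mem_center φ hm hn hη hφ ht ι b hb (MvPolynomial.esymm_isSymmetric _ _ r)

theorem evalOrdered_mem_center [Algebra ℂ A] {f : MvPolynomial (Fin n) ℂ} (hf : f.IsSymmetric) :
    evalOrdered (fun i => φ (z m n η i)) f ∈ Subring.center A := by
  obtain ⟨B, _, _, ι, b, hb⟩ := exists_commRing_lift ℂ (fun i => φ (z m n η i))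
    fun i j => (commute_z hη i j).map φ
  simp only [← hb]
  rw [evalOrdered_eq]
  exact aeval_mem_center φ hm hn hη hφ ht ι b hb hf

end Quotient

/-- The quotient of an algebra by a scalar. -/
theorem exists_quotient_smul {K A : Type} [CommRing K] [Ring A] [Algebra K A] (t : K) :
    ∃ (Q : Type) (_ : Ring Q) (φ : A →+* Q), Function.Surjective φ ∧
      ∀ a, φ a = 0 ↔ ∃ h, a = t • h := by
  let I : Ideal A := Ideal.span {algebraMap K A t}
  have hI : ∀ b, b ∈ I ↔ ∃ h, h * algebraMap K A t = b := fun b => Ideal.mem_span_singleton'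
  -- The left ideal generated by t is two-sided because t is central.
  have : I.IsTwoSided := ⟨fun {b} c hb => by
    obtain ⟨h, rfl⟩ := (hI b).1 hb
    exact (hI _).2 ⟨h * c, by rw [mul_assoc, mul_assoc, Algebra.commutes]⟩⟩
  refine ⟨A ⧸ I, inferInstance, Ideal.Quotient.mk I, Ideal.Quotient.mk_surjective, fun a => ?_⟩
  rw [Ideal.Quotient.eq_zero_iff_mem, hI]
  simp only [Algebra.smul_def, Algebra.commutes, eq_comm]

/-- The commutators of the `S_r` lie in `t H_R`. -/
theorem exists_commutator_S_eq {m n : ℕ} {η : ℂ} (hm : 0 < m) (hn : 0 < n)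
    (hη : η ≠ 0) (a : H m n η) (r : ℕ) :
    ∃ h : H m n η, a * S m n η r - S m n η r * a = tR m • h := by
  -- In this quotient the kernel is exactly t H_R, so centrality of the image of S_r is the claim.
  obtain ⟨Q, _, φ, hφ, hker⟩ := exists_quotient_smul (A := H m n η) (tR m)
  have h := map_S_mem_center φ hm hn hη hφ ((hker _).2 ⟨1, rfl⟩) r
  refine (hker _).1 ((map_sub φ _ _).trans ?_)
  rw [map_mul, map_mul, Subring.mem_center_iff.1 h (φ a), sub_self]

/-! ### Base change to R/I as a quotient of the algebra. -/

section Specialization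

variable {K A : Type} [CommRing K] [Ring A] [Algebra K A] (I : Ideal K)

/-- The specialisation map. -/
def specHom : A →+* (K ⧸ I) ⊗[K] A :=
  (Algebra.TensorProduct.includeRight : A →ₐ[K] (K ⧸ I) ⊗[K] A).toRingHom

theorem specHom_apply (a : A) : specHom I a = (1 : K ⧸ I) ⊗ₜ[K] a := rfl

theorem specHom_surjective : Function.Surjective (specHom (A := A) I) := by
  intro a
  induction a using TensorProduct.induction_on with
  | zero => exact ⟨0, map_zero _⟩
  | tmul r h =>
    obtain ⟨r, rfl⟩ := Ideal.Quotient.mk_surjective r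
    refine ⟨r • h, ?_⟩
    rw [specHom_apply, TensorProduct.tmul_smul, TensorProduct.smul_tmul']
    congr 1
    change Ideal.Quotient.mk _ (r • 1) = _
    rw [smul_eq_mul, mul_one]
  | add a b ha hb =>
    obtain ⟨a, rfl⟩ := ha
    obtain ⟨b, rfl⟩ := hb
    exact ⟨a + b, map_add _ _ _⟩

theorem specHom_smul_one {r : K} (hr : r ∈ I) : specHom I (r • (1 : A)) = 0 := by
  have h : r • (1 : K ⧸ I) = 0 := by
    change Ideal.Quotient.mk _ (r • 1) = 0
    rwa [smul_eq_mul, mul_one, Ideal.Quotient.eq_zero_iff_mem]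
  rw [specHom_apply, TensorProduct.tmul_smul, TensorProduct.smul_tmul', h, TensorProduct.zero_tmul]

/-- The specialisation is one of the quotients killing r, so a fact about all such quotients applies
to it. -/
theorem tmul_mem_center_of_forall {r : K} (hr : r ∈ I) (a : A)
    (h : ∀ (T : Type) [Ring T] (φ : A →+* T), Function.Surjective φ → φ (r • 1) = 0 →
      φ a ∈ Subring.center T) :
    (1 : K ⧸ I) ⊗ₜ[K] a ∈ Subring.center ((K ⧸ I) ⊗[K] A) :=
  h _ (specHom I) (specHom_surjective I) (specHom_smul_one I hr)

theorem evalOrdered_tmul_mem_center_of_forall [Algebra ℂ K] {r : K} (hr : r ∈ I) {n : ℕ}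
    (a : Fin n → A) (f : MvPolynomial (Fin n) ℂ)
    (h : ∀ (T : Type) [Ring T] [Algebra ℂ T] (φ : A →+* T), Function.Surjective φ →
      φ (r • 1) = 0 → evalOrdered (fun i => φ (a i)) f ∈ Subring.center T) :
    evalOrdered (fun i => (1 : K ⧸ I) ⊗ₜ[K] a i) f ∈ Subring.center ((K ⧸ I) ⊗[K] A) :=
  h _ (specHom I) (specHom_surjective I) (specHom_smul_one I hr)

end Specialization

theorem tR_mem_maxIdeal (m : ℕ) (κ : ℂ) (c : Fin (m - 1) → ℂ) : tR m ∈ maxIdeal m 0 κ c := by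
  rw [maxIdeal, RingHom.mem_ker, tR, MvPolynomial.eval_X]
  rfl

end Cherednik

end

/-- The elements `z_i` commute pairwise; `[x_1, S_r]` lies in `t H_R` for every `r`; and, for all
specialisations with `t = 0`, the images in `H_c` of the `S_r`, and more generally all symmetric
polynomials in the images of the `z_i`, are central in `H_c`. -/
theorem mainTheorem1 (m n : ℕ) (hm : 0 < m) (hn : 0 < n) (η : ℂ) (hη : IsPrimitiveRoot η m) :
    (∀ i j : Fin n, Commute (Cherednik.z m n η i) (Cherednik.z m n η j)) ∧
    (∀ r : ℕ, ∃ h : Cherednik.H m n η,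
      Cherednik.x m n η ⟨0, hn⟩ * Cherednik.S m n η r
        - Cherednik.S m n η r * Cherednik.x m n η ⟨0, hn⟩ = Cherednik.tR m • h) ∧
    (∀ (κ : ℂ) (c : Fin (m - 1) → ℂ),
      (∀ r : ℕ, Cherednik.spec m n η 0 κ c (Cherednik.S m n η r) ∈
        Subring.center (Cherednik.Hspec m n η 0 κ c)) ∧
      (∀ f : MvPolynomial (Fin n) ℂ, f.IsSymmetric →
        Cherednik.evalOrdered
            (fun i => Cherednik.spec m n η 0 κ c (Cherednik.z m n η i)) f ∈
          Subring.center (Cherednik.Hspec m n η 0 κ c))) := by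
  have hη₀ : η ≠ 0 := hη.ne_zero hm.ne'
  refine ⟨Cherednik.commute_z hη₀, Cherednik.exists_commutator_S_eq hm hn hη₀ _, fun κ c => ?_⟩
  have ht := Cherednik.tR_mem_maxIdeal m κ c
  exact ⟨fun r => Cherednik.tmul_mem_center_of_forall (K := Cherednik.R m)
      (A := Cherednik.H m n η) _ ht (Cherednik.S m n η r)
      fun _ _ φ hφ hφt => Cherednik.map_S_mem_center φ hm hn hη₀ hφ hφt r,
    fun f hf => Cherednik.evalOrdered_tmul_mem_center_of_forall (K := Cherednik.R m)
      (A := Cherednik.H m n η) _ ht (Cherednik.z m n η) f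
      fun _ _ _ φ hφ hφt => Cherednik.evalOrdered_mem_center φ hm hn hη₀ hφ hφt hf⟩
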